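/- Let $\mathbb B_N$ be the open unit ball of $\mathbb C^N$, whose points are written as row vectors, and let $\langle\lambda,\mu\rangle=\lambda\mu^*$. A function $s:\mathbb B_N\to\mathbb C^{m\times n}$ is called a *Schur multiplier* (of the Drury–Arveson space) if the kernel $$\frac{I_m-s(\lambda)s(\mu)^*}{1-\langle\lambda,\mu\rangle}$$ is positive on $\mathbb B_N$, i.e. $\sum_{i,j}c_i^*\,\frac{I_m-s(\lambda_i)s(\lambda_j)^*}{1-\langle\lambda_i,\lambda_j\rangle}\,c_j\ge 0$ for all finite families $\lambda_i\in\mathbb B_N$, $c_i\in\mathbb C^m$. For $\nu\in\mathbb B_N$ the *Blaschke factor* is the row-vector-valued function $$b_\nu(\lambda)=\frac{(1-\langle\nu,\nu\rangle)^{1/2}}{1-\langle\lambda,\nu\rangle}\,(\lambda-\nu)\,(I_N-\nu^*\nu)^{-1/2}\in\mathbb C^{1\times N}.$$ **Theorem (tangential Schwarz lemma).** Let $p\ge1$, let $s$ be a $\mathbb C^{p\times q}$-valued Schur multiplier and let $\nu\in\mathbb B_N$. Let $\xi\in\mathbb C^p$ and $\eta\in\mathbb C^q$ satisfy $\eta^*\eta<\xi^*\xi$.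 Put $c=\begin{pmatrix}\xi\\ \eta\end{pmatrix}$ and $J_{p,q}=\begin{pmatrix}I_p&0\\0&-I_q\end{pmatrix}$, so that $c^*J_{p,q}c=\xi^*\xi-\eta^*\eta>0$. Let $U=\begin{pmatrix}U_1&U_2\\U_3&U_4\end{pmatrix}$ be any $p\times p$ unitary matrix whose last column is $\begin{pmatrix}U_2\\U_4\end{pmatrix}=\xi/\sqrt{\xi^*\xi}$, so that $\begin{pmatrix}U_1\\U_3\end{pmatrix}$ consists of its first $p-1$ columns. Then, for every $\mathbb C^{(p-1+N)\times q}$-valued Schur multiplier $s_\nu$ and every $\lambda\in\mathbb B_N$, the $q\times q$ matrix that is inverted in the formula below is invertible, and $$\xi^*s(\nu)=\eta^*$$ if and only if there exists a $\mathbb C^{(p-1+N)\times q}$-valued Schur multiplier $s_\nu$ (in general not unique) such that, for all $\lambda\in\mathbb B_N$, $$\begin{aligned} s(\lambda)={}&\left(\begin{pmatrix}\dfrac{\xi\, b_\nu(\lambda)}{\sqrt{c^*J_{p,q}c}}&\begin{pmatrix}U_1\\U_3\end{pmatrix}\end{pmatrix}s_\nu(\lambda)+\frac{\xi\eta^*}{c^*J_{p,q}c}\left(I_q+\frac{\eta\eta^*}{c^*J_{p,q}c}\right)^{-1/2}\right)\\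 &\times\left(\begin{pmatrix}\dfrac{\eta\, b_\nu(\lambda)}{\sqrt{c^*J_{p,q}c}}&0_{q\times(p-1)}\end{pmatrix}s_\nu(\lambda)+\left(I_q+\frac{\eta\eta^*}{c^*J_{p,q}c}\right)^{1/2}\right)^{-1}. \end{aligned}$$ -/

import Mathlib

open scoped ComplexOrder MatrixOrder Matrix

noncomputable section

/-- A matrix-valued kernel `K` on `Ω` is positive: `∑ᵢⱼ cᵢ* K(zᵢ, zⱼ) cⱼ ≥ 0` for all finite
families of points `zᵢ` and vectors `cᵢ`. Equivalently, the scalar matrix indexed by pairs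
(point, coordinate) is positive semidefinite. -/
def IsPositiveKernel {Ω ι : Type*} (K : Ω → Ω → Matrix ι ι ℂ) : Prop :=
  Matrix.PosSemidef (Matrix.of fun x y : Ω × ι => K x.1 y.1 x.2 y.2)

/-- `s` is a Schur multiplier of the reproducing kernel Hilbert space with kernel `k`:
the kernel `(I - s(z) s(w)*) k(z, w)` is positive. -/
def IsSchurMultiplier {Ω ι κ : Type*} [DecidableEq ι] [Fintype κ]
    (k : Ω → Ω → ℂ) (s : Ω → Matrix ι κ ℂ) : Prop :=
  IsPositiveKernel fun z w => k z w • (1 - s z * (s w)ᴴ)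

/-- The open unit ball of `ℂ^N`. -/
abbrev UnitBall (N : ℕ) : Type := Metric.ball (0 : EuclideanSpace ℂ (Fin N)) 1

/-- The Drury–Arveson kernel `1 / (1 - ⟨z, w⟩)`, with `⟨z, w⟩ = ∑ᵢ zᵢ conj(wᵢ)`
(Mathlib's `inner` is conjugate-linear in its first argument). -/
def druryArvesonKernel (N : ℕ) (z w : UnitBall N) : ℂ :=
  1 / (1 - inner ℂ (w : EuclideanSpace ℂ (Fin N)) (z : EuclideanSpace ℂ (Fin N)))

/-- The Blaschke factor, a row vector:
`b_ν(z) = (1 - ⟨ν, ν⟩)^{1/2} / (1 - ⟨z, ν⟩) · (z - ν) (I - ν* ν)^{-1/2}`,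
where points of the ball are rows, so that `ν* ν` is an `N × N` matrix. -/
def blaschkeFactor {N : ℕ} (ν z : UnitBall N) : Fin N → ℂ :=
  ((Real.sqrt (1 - ‖(ν : EuclideanSpace ℂ (Fin N))‖ ^ 2) : ℂ) /
      (1 - inner ℂ (ν : EuclideanSpace ℂ (Fin N)) (z : EuclideanSpace ℂ (Fin N)))) •
    (((z : EuclideanSpace ℂ (Fin N)) - (ν : EuclideanSpace ℂ (Fin N))).ofLp ᵥ*
      (CFC.sqrt (1 - Matrix.vecMulVec (star (ν : EuclideanSpace ℂ (Fin N)).ofLp)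
        (ν : EuclideanSpace ℂ (Fin N)).ofLp))⁻¹)

/-- The signature matrix `J_{p,q} = diag(I_p, -I_q)`. -/
def signatureMatrix (p q : ℕ) : Matrix (Fin p ⊕ Fin q) (Fin p ⊕ Fin q) ℂ :=
  Matrix.fromBlocks 1 0 0 (-1)

/-- The number `c* J_{p,q} c` for `c = (ξ, η)`. It is real, equal to `ξ*ξ - η*η`. -/
def cJc {p q : ℕ} (ξ : Fin p → ℂ) (η : Fin q → ℂ) : ℝ :=
  (star (Sum.elim ξ η) ⬝ᵥ (signatureMatrix p q *ᵥ Sum.elim ξ η)).re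

/-- The positive semidefinite square root `(I_q + η η* / (c* J_{p,q} c))^{1/2}`. -/
def etaRoot {p q : ℕ} (ξ : Fin p → ℂ) (η : Fin q → ℂ) : Matrix (Fin q) (Fin q) ℂ :=
  CFC.sqrt (1 + ((cJc ξ η : ℂ)⁻¹) • Matrix.vecMulVec η (star η))

/-- The numerator of the linear fractional transformation. Here `p = r + 1`; the matrix of the
first `p - 1` columns of `U` is `U.submatrix id Fin.castSucc`, and `(p - 1 + N)`-dimensional space
is indexed by `Fin N ⊕ Fin r`, the `N` coordinates that meet the Blaschke factor coming first. -/
def lftNum {N r q : ℕ} (ν : UnitBall N) (ξ : Fin (r + 1) → ℂ) (η : Fin q → ℂ)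
    (U : Matrix (Fin (r + 1)) (Fin (r + 1)) ℂ)
    (sν : UnitBall N → Matrix (Fin N ⊕ Fin r) (Fin q) ℂ) (z : UnitBall N) :
    Matrix (Fin (r + 1)) (Fin q) ℂ :=
  Matrix.fromCols
      (((Real.sqrt (cJc ξ η) : ℂ)⁻¹) • Matrix.vecMulVec ξ (blaschkeFactor ν z))
      (U.submatrix id Fin.castSucc) * sν z
    + ((cJc ξ η : ℂ)⁻¹) • (Matrix.vecMulVec ξ (star η) * (etaRoot ξ η)⁻¹)

/-- The denominator of the linear fractional transformation. -/
def lftDen {N r q : ℕ} (ν : UnitBall N) (ξ : Fin (r + 1) → ℂ) (η : Fin q → ℂ)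
    (sν : UnitBall N → Matrix (Fin N ⊕ Fin r) (Fin q) ℂ) (z : UnitBall N) :
    Matrix (Fin q) (Fin q) ℂ :=
  Matrix.fromCols
      (((Real.sqrt (cJc ξ η) : ℂ)⁻¹) • Matrix.vecMulVec η (blaschkeFactor ν z))
      (0 : Matrix (Fin q) (Fin r) ℂ) * sν z
    + etaRoot ξ η

end

/-!
The condition `ξ* s(ν) = η*` is a tangential Nevanlinna–Pick condition, and the linear fractional
formula is its solution by one step of a Schur algorithm. Let `k` be the Drury–Arveson kernel, `b`
the Blaschke factor at `ν`, `δ = c* J c = ξ* ξ - η* η`, and let `Θ = [A, B; C, D]` be the coefficient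
matrix of the transformation. Everything rests on two identities,

* `1 - b(z) b(w)* = (1 - |ν|²) (1 - ⟨z, w⟩) / ((1 - ⟨z, ν⟩) (1 - ⟨ν, w⟩))`
  (`blaschkeFactor_dotProduct`),
* `Θ(z) J Θ(w)* = J - c c* (1 - b(z) b(w)*) / δ`
  (`lftNumCoeff_mul`, `lftNumCoeff_mul_lftDenCoeff`, `lftDenCoeff_mul`).

The lower right block of the second one makes the denominator `C sν + D` invertible
(`isUnit_lftDen`). Since `b(ν) = 0` and the first columns of `U` are orthogonal to `ξ`, every value of
the transformation satisfies the interpolation condition (`star_vecMul_lft`).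

Conversely, let `ξ* s(ν) = η*` and put `P = A - s C`, `Q = s D - B`. Multiplying the second identity
by `(1, -s(z))` and `(1, -s(w))*` shows that `k (P P* - Q Q*)` is the kernel `k (1 - s s*)` minus
`k(z, ν) (ξ - s(z) η) (ξ - s(w) η)* k(ν, w) (1 - |ν|²) / δ`. By the interpolation condition this is the
Schur complement of `k (1 - s s*)` along the direction `ξ` at the point `ν`, so it is positive
(`Matrix.PosSemidef.sub_rankOne`). Leech's theorem (`exists_schurMultiplier_mul_eq`) then gives a Schur
multiplier `sν` with `P sν = Q`, that is `s (C sν + D) = A sν + B`. Leech's theorem itself is proved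
by the lurking isometry argument: the positive kernel is factored through a Hilbert space, equality
of Gram matrices yields a contraction, and its transfer function is the multiplier.
-/

open scoped InnerProductSpace ComplexConjugate

/-! ### Positive kernels and Hilbert spaces -/

/-- Gram matrices are positive semidefinite, for an arbitrary index type. -/
theorem posSemidef_of_forall_inner {X E : Type*} [NormedAddCommGroup E] [InnerProductSpace ℂ E]
    (v : X → E) : Matrix.PosSemidef (Matrix.of fun x y => ⟪v x, v y⟫_ℂ) := by
  refine ⟨Matrix.ext fun x y => inner_conj_symm _ _, fun c => ?_⟩
  have h : (c.sum fun i xi => c.sum fun j xj =>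
      star xi * (Matrix.of fun x y => ⟪v x, v y⟫_ℂ) i j * xj) =
      ⟪c.sum fun i a => a • v i, c.sum fun i a => a • v i⟫_ℂ := by
    simp only [Finsupp.sum, sum_inner, inner_sum, inner_smul_left, inner_smul_right,
      Finset.mul_sum]
    rw [Finset.sum_comm]
    refine Finset.sum_congr rfl fun i _ => Finset.sum_congr rfl fun j _ => ?_
    simp only [Matrix.of_apply, RCLike.star_def]
    ring
  rw [h, inner_self_eq_norm_sq_to_K]
  positivity

/-- Kolmogorov factorization: a positive semidefinite matrix over any index type is the Gram matrix
of a family in a Hilbert space, here the kernel functions of its reproducing kernel space. -/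
theorem exists_inner_eq_of_posSemidef {X : Type} {M : Matrix X X ℂ} (hM : M.PosSemidef) :
    ∃ (H : Type) (_ : NormedAddCommGroup H) (_ : InnerProductSpace ℂ H) (_ : CompleteSpace H)
      (φ : X → H), ∀ x y, ⟪φ x, φ y⟫_ℂ = M x y := by
  let K : Matrix X X (ℂ →L[ℂ] ℂ) := Matrix.of fun x y => M x y • ContinuousLinearMap.id ℂ ℂ
  have hM1 : ∀ x y, conj (M x y) = M y x := fun x y => hM.1.apply y x
  have hK : K.PosSemidef := by
    have htfae := (RKHS.posSemidef_tfae (𝕜 := ℂ) (K := K)).out 0 2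
    refine htfae.mpr ⟨?_, fun c => ?_⟩
    · refine Matrix.ext fun x y => ?_
      refine ContinuousLinearMap.ext fun v => ext_inner_right ℂ fun w => ?_
      rw [Matrix.conjTranspose_apply, ContinuousLinearMap.star_eq_adjoint,
        ContinuousLinearMap.adjoint_inner_left]
      simp [K, hM1]
      ring
    · have h := (Complex.le_def.mp (hM.2 c)).1
      rw [Complex.zero_re] at h
      convert h using 1
      rw [RCLike.re_eq_complex_re]
      refine congrArg _ ?_
      simp only [Finsupp.sum]
      refine Finset.sum_congr rfl fun i _ => Finset.sum_congr rfl fun j _ => ?_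
      simp [K, hM1]
      ring
  have : Fact K.PosSemidef := ⟨hK⟩
  refine ⟨RKHS.OfKernel K, inferInstance, inferInstance, inferInstance,
    fun x => RKHS.kerFun (RKHS.OfKernel K) x 1, fun x y => ?_⟩
  rw [← RKHS.kernel_inner, RKHS.OfKernel.kernel_ofKernel]
  simp [K, hM1]

/-- Two families with the same Gram matrix are related by a contraction: the isometry between their
spans extends to the closure, and is precomposed with the orthogonal projection. -/
theorem exists_contraction_of_inner_eq {X E F : Type*} [NormedAddCommGroup E]
    [InnerProductSpace ℂ E] [CompleteSpace E] [NormedAddCommGroup F] [InnerProductSpace ℂ F]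
    [CompleteSpace F] (v : X → E) (w : X → F) (h : ∀ x y, ⟪v x, v y⟫_ℂ = ⟪w x, w y⟫_ℂ) :
    ∃ V : E →L[ℂ] F, (∀ x, V (v x) = w x) ∧ ∀ u, ‖V u‖ ≤ ‖u‖ := by
  let T : (X →₀ ℂ) →ₗ[ℂ] E := Finsupp.linearCombination ℂ v
  let S : (X →₀ ℂ) →ₗ[ℂ] F := Finsupp.linearCombination ℂ w
  have hTS : ∀ c, ‖S c‖ = ‖T c‖ := fun c => by
    have : ⟪S c, S c⟫_ℂ = ⟪T c, T c⟫_ℂ := by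
      simp only [S, T, Finsupp.linearCombination_apply, Finsupp.sum, sum_inner, inner_sum,
        inner_smul_left, inner_smul_right, h]
    rw [inner_self_eq_norm_sq_to_K, inner_self_eq_norm_sq_to_K] at this
    have h2 : ‖S c‖ ^ 2 = ‖T c‖ ^ 2 := by exact_mod_cast this
    exact (pow_left_inj₀ (norm_nonneg _) (norm_nonneg _) two_ne_zero).1 h2
  let M := (LinearMap.range T).topologicalClosure
  let e : (X →₀ ℂ) →ₗ[ℂ] M := T.codRestrict M fun c =>
    Submodule.le_topologicalClosure _ (LinearMap.mem_range_self T c)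
  have he : DenseRange e := by
    refine Subtype.dense_iff.2 fun x hx => ?_
    rw [← Set.range_comp]
    exact hx
  have hb : ∀ c, ‖S c‖ ≤ 1 * ‖e c‖ := fun c => by
    rw [one_mul, hTS]; rfl
  refine ⟨(S.extendOfNorm e).comp M.orthogonalProjectionOnto, fun x => ?_, fun u => ?_⟩
  · have h1 : v x = e (Finsupp.single x 1) := by simp [e, T]
    rw [h1, ContinuousLinearMap.comp_apply, M.orthogonalProjectionOnto_mem_subspace_eq_self,
      LinearMap.extendOfNorm_eq he ⟨1, hb⟩]
    simp [S]
  · have := LinearMap.norm_extendOfNorm_apply_le he 1 hb (M.orthogonalProjectionOnto u)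
    rw [one_mul] at this
    exact this.trans (M.norm_orthogonalProjectionOnto_apply_le u)

/-- The form `⟪u, (1 - V* V) u⟫` of a contraction `V` is positive semidefinite on every family. -/
theorem posSemidef_defect {X E F : Type*} [NormedAddCommGroup E]
    [InnerProductSpace ℂ E] [NormedAddCommGroup F] [InnerProductSpace ℂ F]
    (V : E →L[ℂ] F) (hV : ∀ u, ‖V u‖ ≤ ‖u‖) (v : X → E) :
    Matrix.PosSemidef (Matrix.of fun x y => ⟪v x, v y⟫_ℂ - ⟪V (v x), V (v y)⟫_ℂ) := by
  refine ⟨Matrix.ext fun x y => ?_, fun c => ?_⟩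
  · simp
  have h : (c.sum fun i xi => c.sum fun j xj =>
      star xi * (Matrix.of fun x y => ⟪v x, v y⟫_ℂ - ⟪V (v x), V (v y)⟫_ℂ) i j * xj) =
      ⟪c.sum fun i a => a • v i, c.sum fun i a => a • v i⟫_ℂ -
      ⟪V (c.sum fun i a => a • v i), V (c.sum fun i a => a • v i)⟫_ℂ := by
    simp only [Finsupp.sum, sum_inner, inner_sum, inner_smul_left, inner_smul_right, map_sum,
      map_smul, Finset.mul_sum, ← Finset.sum_sub_distrib]
    rw [Finset.sum_comm]
    refine Finset.sum_congr rfl fun i _ => Finset.sum_congr rfl fun j _ => ?_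
    simp only [Matrix.of_apply, RCLike.star_def]
    ring
  rw [h, inner_self_eq_norm_sq_to_K, inner_self_eq_norm_sq_to_K, sub_nonneg]
  have := hV (c.sum fun i a => a • v i)
  exact_mod_cast pow_le_pow_left₀ (norm_nonneg _) this 2

theorem norm_inner_lt_one {N : ℕ} (z w : UnitBall N) :
    ‖inner ℂ (w : EuclideanSpace ℂ (Fin N)) (z : EuclideanSpace ℂ (Fin N))‖ < 1 := by
  have hz : ‖(z : EuclideanSpace ℂ (Fin N))‖ < 1 := mem_ball_zero_iff.1 z.2
  have hw : ‖(w : EuclideanSpace ℂ (Fin N))‖ < 1 := mem_ball_zero_iff.1 w.2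
  refine (norm_inner_le_norm _ _).trans_lt ?_
  nlinarith [norm_nonneg (z : EuclideanSpace ℂ (Fin N)), norm_nonneg (w : EuclideanSpace ℂ (Fin N))]

theorem one_sub_inner_ne_zero {N : ℕ} (z w : UnitBall N) :
    1 - inner ℂ (w : EuclideanSpace ℂ (Fin N)) (z : EuclideanSpace ℂ (Fin N)) ≠ 0 := by
  intro h
  have := norm_inner_lt_one z w
  rw [← sub_eq_zero.1 h] at this
  simp at this

/-- By the Schur product theorem, every term of the geometric series `∑ₙ ⟨z, w⟩ⁿ` is a positive
kernel, hence so is its sum. -/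
theorem posSemidef_druryArvesonKernel {N : ℕ} {X : Type*} (f : X → UnitBall N) :
    Matrix.PosSemidef (Matrix.of fun x y => druryArvesonKernel N (f x) (f y)) := by
  have hG : Matrix.PosSemidef (Matrix.of fun x y =>
      inner ℂ (f y : EuclideanSpace ℂ (Fin N)) (f x : EuclideanSpace ℂ (Fin N))) :=
    (posSemidef_of_forall_inner fun x => (f x : EuclideanSpace ℂ (Fin N))).transpose
  have hpow : ∀ n : ℕ, Matrix.PosSemidef (Matrix.of fun x y =>
      inner ℂ (f y : EuclideanSpace ℂ (Fin N)) (f x : EuclideanSpace ℂ (Fin N)) ^ n) := by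
    intro n
    induction n with
    | zero =>
      have := posSemidef_of_forall_inner (fun _ : X => (1 : ℂ))
      simpa using this
    | succ n ih =>
      have := ih.hadamard hG
      exact this
  have hsum : ∀ x y, HasSum (fun n : ℕ =>
      inner ℂ (f y : EuclideanSpace ℂ (Fin N)) (f x : EuclideanSpace ℂ (Fin N)) ^ n)
      (druryArvesonKernel N (f x) (f y)) := fun x y => by
    rw [druryArvesonKernel, one_div]
    exact hasSum_geometric_of_norm_lt_one (norm_inner_lt_one _ _)
  refine ⟨Matrix.ext fun x y => ?_, fun c => ?_⟩
  · simp [druryArvesonKernel]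
  · have : HasSum (fun n : ℕ => c.sum fun i xi => c.sum fun j xj => star xi *
        inner ℂ (f j : EuclideanSpace ℂ (Fin N)) (f i : EuclideanSpace ℂ (Fin N)) ^ n * xj)
        (c.sum fun i xi => c.sum fun j xj => star xi * druryArvesonKernel N (f i) (f j) * xj) := by
      refine hasSum_sum fun i _ => hasSum_sum fun j _ => ?_
      exact ((hsum i j).mul_left _).mul_right _
    exact this.nonneg fun n => (hpow n).2 c

/-- The Schur complement of a positive kernel along one direction `c` supported on finitely many
points is positive. In a Gram representation it is the Gram matrix of the components orthogonal to
`u = ∑ᵢ cᵢ φ(fᵢ)`. -/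
theorem Matrix.PosSemidef.sub_rankOne {X κ : Type} [Fintype κ] {M : Matrix X X ℂ}
    (hM : M.PosSemidef) (f : κ → X) (c : κ → ℂ) {a : ℝ}
    (ha : ∑ i, ∑ j, star (c i) * M (f i) (f j) * c j = a) (ha0 : 0 < a) :
    Matrix.PosSemidef (Matrix.of fun x y => M x y -
      (∑ i, M x (f i) * c i) * star (∑ i, M y (f i) * c i) / a) := by
  obtain ⟨H, _, _, _, φ, hφ⟩ := exists_inner_eq_of_posSemidef hM
  set u := ∑ i, c i • φ (f i) with hu
  have h1 : ∀ x, ⟪φ x, u⟫_ℂ = ∑ i, M x (f i) * c i := fun x => by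
    simp only [hu, inner_sum, inner_smul_right, hφ, mul_comm]
  have h2 : ⟪u, u⟫_ℂ = a := by
    rw [← ha]
    conv_lhs => rw [hu]
    simp only [sum_inner, inner_sum, inner_smul_left, inner_smul_right, hφ, Finset.mul_sum]
    rw [Finset.sum_comm]
    refine Finset.sum_congr rfl fun i _ => Finset.sum_congr rfl fun j _ => ?_
    simp only [RCLike.star_def]
    ring
  convert posSemidef_of_forall_inner (fun x => φ x - (⟪u, φ x⟫_ℂ / a) • u) using 1
  ext x y
  have ha' : (a : ℂ) ≠ 0 := by exact_mod_cast ha0.ne'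
  have h3 : ∀ x, ⟪u, φ x⟫_ℂ = star ⟪φ x, u⟫_ℂ := fun x => (inner_conj_symm _ _).symm
  simp only [Matrix.of_apply, inner_sub_left, inner_sub_right, inner_smul_left, inner_smul_right,
    hφ, h2, ← h1, h3, map_div₀, RCLike.star_def, Complex.conj_conj, Complex.conj_ofReal]
  field_simp
  ring

/-! ### Leech's theorem -/

/-- The adjoint `h ↦ (conj z₁ • h, …, conj z_N • h)` of the row operator
`(h₁, …, h_N) ↦ ∑ₖ zₖ • hₖ` from `H^N` to `H`. -/
def rowAdjoint {N : ℕ} (H : Type*) [NormedAddCommGroup H] [InnerProductSpace ℂ H]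
    (z : EuclideanSpace ℂ (Fin N)) : H →ₗ[ℂ] PiLp 2 (fun _ : Fin N => H) where
  toFun h := WithLp.toLp 2 fun k => conj (z k) • h
  map_add' h h' := by ext k; simp
  map_smul' a h := by ext k; exact smul_comm _ _ _

theorem inner_rowAdjoint {N : ℕ} {H : Type*} [NormedAddCommGroup H] [InnerProductSpace ℂ H]
    (z w : EuclideanSpace ℂ (Fin N)) (h h' : H) :
    ⟪rowAdjoint H z h, rowAdjoint H w h'⟫_ℂ = ⟪w, z⟫_ℂ * ⟪h, h'⟫_ℂ := by
  simp only [rowAdjoint, LinearMap.coe_mk, AddHom.coe_mk, PiLp.inner_apply, inner_smul_left,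
    inner_smul_right, Complex.conj_conj, RCLike.inner_apply, Finset.sum_mul]
  exact Finset.sum_congr rfl fun k _ => by ring

theorem norm_rowAdjoint {N : ℕ} {H : Type*} [NormedAddCommGroup H] [InnerProductSpace ℂ H]
    (z : EuclideanSpace ℂ (Fin N)) (h : H) : ‖rowAdjoint H z h‖ = ‖z‖ * ‖h‖ := by
  have := inner_rowAdjoint z z h h
  simp only [inner_self_eq_norm_sq_to_K] at this
  have h2 : ‖rowAdjoint H z h‖ ^ 2 = (‖z‖ * ‖h‖) ^ 2 := by
    rw [mul_pow]; exact_mod_cast this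
  exact (pow_left_inj₀ (norm_nonneg _) (by positivity) two_ne_zero).1 h2

theorem WithLp.norm_snd_le_of_L2 {C H : Type*} [NormedAddCommGroup C] [NormedAddCommGroup H]
    (x : WithLp 2 (C × H)) : ‖x.snd‖ ≤ ‖x‖ := by
  have := WithLp.prod_norm_sq_eq_of_L2 x
  nlinarith [norm_nonneg x, norm_nonneg x.snd, norm_nonneg x.fst]

/-- For a contraction `V` and a strict contraction `R`, the state equation `(V (a, R h))₂ = h` has a
unique solution `h`, and it depends linearly on the input `a`. -/
theorem exists_state_map {A B C H : Type*} [NormedAddCommGroup A] [InnerProductSpace ℂ A]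
    [NormedAddCommGroup B] [InnerProductSpace ℂ B] [NormedAddCommGroup C] [InnerProductSpace ℂ C]
    [NormedAddCommGroup H] [InnerProductSpace ℂ H] [CompleteSpace H]
    (V : WithLp 2 (A × B) →L[ℂ] WithLp 2 (C × H)) (hV : ∀ u, ‖V u‖ ≤ ‖u‖)
    (R : H →ₗ[ℂ] B) {r : ℝ} (hr : r < 1) (hR : ∀ h, ‖R h‖ ≤ r * ‖h‖) :
    ∃ E : A →ₗ[ℂ] H, ∀ a h, (V (WithLp.toLp 2 (a, R h))).snd = h ↔ h = E a := by
  let T₀ : H →ₗ[ℂ] H :=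
    { toFun := fun h => (V (WithLp.toLp 2 (0, R h))).snd
      map_add' := fun h h' => by
        rw [← WithLp.add_snd, ← map_add, ← WithLp.toLp_add]; simp
      map_smul' := fun c h => by
        rw [RingHom.id_apply, ← WithLp.smul_snd, ← map_smul, ← WithLp.toLp_smul]; simp }
  let L : A →ₗ[ℂ] H :=
    { toFun := fun a => (V (WithLp.toLp 2 (a, 0))).snd
      map_add' := fun h h' => by
        rw [← WithLp.add_snd, ← map_add, ← WithLp.toLp_add]; simp
      map_smul' := fun c h => by
        rw [RingHom.id_apply, ← WithLp.smul_snd, ← map_smul, ← WithLp.toLp_smul]; simp }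
  have hsplit : ∀ a h, (V (WithLp.toLp 2 (a, R h))).snd = L a + T₀ h := fun a h => by
    change _ = (V (WithLp.toLp 2 (a, 0))).snd + (V (WithLp.toLp 2 (0, R h))).snd
    rw [← WithLp.add_snd, ← map_add, ← WithLp.toLp_add]; simp
  have hT₀ : ∀ h, ‖T₀ h‖ ≤ max r 0 * ‖h‖ := fun h => by
    refine (WithLp.norm_snd_le_of_L2 _).trans ((hV _).trans ?_)
    rw [WithLp.norm_toLp_snd]
    exact (hR h).trans (mul_le_mul_of_nonneg_right (le_max_left _ _) (norm_nonneg _))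
  let T : H →L[ℂ] H := T₀.mkContinuous _ hT₀
  have hT : ‖T‖ < 1 :=
    (T₀.mkContinuous_norm_le (le_max_right _ _) hT₀).trans_lt (max_lt hr one_pos)
  let W := Units.oneSub T hT
  refine ⟨(W⁻¹ : (H →L[ℂ] H)ˣ).val.toLinearMap ∘ₗ L, fun a h => ?_⟩
  rw [hsplit]
  have hW : ∀ h, W.val h = h - T₀ h := fun h => rfl
  have h1 : ∀ h, W⁻¹.val (W.val h) = h := fun h => by
    rw [← mul_apply_eq_comp, Units.inv_mul]; rfl
  have h2 : ∀ h, W.val (W⁻¹.val h) = h := fun h => by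
    rw [← mul_apply_eq_comp, Units.mul_inv]; rfl
  change _ ↔ h = W⁻¹.val (L a)
  constructor
  · intro e
    rw [← h1 h, hW]
    nth_rewrite 1 [← e]
    rw [add_sub_cancel_right]
  · rintro rfl
    have := hW (W⁻¹.val (L a))
    rw [h2] at this
    exact (eq_sub_iff_add_eq.1 this)

/-- Leech's theorem for the Drury–Arveson space. Writing the positive kernel as a Gram matrix of
`φ`, the identity `P P* + ⟨z, w⟩ φ φ* = Q Q* + φ φ*` says that the vectors
`(P(z)* eᵢ, z* φ(z, i))` and `(Q(z)* eᵢ, φ(z, i))` have the same Gram matrix. A contraction `V` taking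
the former to the latter is the colligation whose transfer function is `S*`. -/
theorem exists_schurMultiplier_mul_eq {N : ℕ} {ι κ τ : Type} [Fintype κ] [DecidableEq κ] [Fintype τ]
    (P : UnitBall N → Matrix ι κ ℂ) (Q : UnitBall N → Matrix ι τ ℂ)
    (h : IsPositiveKernel fun z w =>
      druryArvesonKernel N z w • (P z * (P w)ᴴ - Q z * (Q w)ᴴ)) :
    ∃ S : UnitBall N → Matrix κ τ ℂ,
      IsSchurMultiplier (druryArvesonKernel N) S ∧ ∀ z, P z * S z = Q z := by
  obtain ⟨H, _, _, _, φ, hφ⟩ := exists_inner_eq_of_posSemidef h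
  let R (z : UnitBall N) := rowAdjoint H (z : EuclideanSpace ℂ (Fin N))
  let p (x : UnitBall N × ι) : EuclideanSpace ℂ κ := WithLp.toLp 2 fun k => conj (P x.1 x.2 k)
  let t (x : UnitBall N × ι) : EuclideanSpace ℂ τ := WithLp.toLp 2 fun k => conj (Q x.1 x.2 k)
  obtain ⟨V, hVφ, hV⟩ := exists_contraction_of_inner_eq
    (fun x => (WithLp.toLp 2 (p x, R x.1 (φ x)) :
      WithLp 2 (EuclideanSpace ℂ κ × PiLp 2 (fun _ : Fin N => H))))
    (fun x => (WithLp.toLp 2 (t x, φ x) : WithLp 2 (EuclideanSpace ℂ τ × H))) (by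
      rintro ⟨z, i⟩ ⟨w, j⟩
      have hz := one_sub_inner_ne_zero z w
      simp only [WithLp.prod_inner_apply, R, inner_rowAdjoint]
      have h1 : ⟪p (z, i), p (w, j)⟫_ℂ = (P z * (P w)ᴴ) i j := by
        simp [p, PiLp.inner_apply, Matrix.mul_apply, mul_comm]
      have h2 : ⟪t (z, i), t (w, j)⟫_ℂ = (Q z * (Q w)ᴴ) i j := by
        simp [t, PiLp.inner_apply, Matrix.mul_apply, mul_comm]
      have h3 := hφ (z, i) (w, j)
      simp only [Matrix.of_apply, Matrix.smul_apply, Matrix.sub_apply, druryArvesonKernel,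
        smul_eq_mul] at h3
      rw [h1, h2, h3]
      field_simp
      ring)
  have hnorm : ∀ z : UnitBall N, ‖(z : EuclideanSpace ℂ (Fin N))‖ < 1 :=
    fun z => mem_ball_zero_iff.1 z.2
  choose E hE using fun z : UnitBall N =>
    exists_state_map V hV (R z) (hnorm z) fun h => (norm_rowAdjoint _ _).le
  have hEu : ∀ z a, (V (WithLp.toLp 2 (a, R z (E z a)))).snd = E z a :=
    fun z a => (hE z a _).2 rfl
  -- the transfer function of the colligation `V`, as a linear map
  let F (z : UnitBall N) : EuclideanSpace ℂ κ →ₗ[ℂ] EuclideanSpace ℂ τ :=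
    { toFun := fun a => (V (WithLp.toLp 2 (a, R z (E z a)))).fst
      map_add' := fun a b => by
        have hab : WithLp.toLp 2 (a + b, R z (E z (a + b))) =
            WithLp.toLp 2 (a, R z (E z a)) + WithLp.toLp 2 (b, R z (E z b)) := by
          rw [map_add, map_add]; rfl
        rw [hab, map_add]; rfl
      map_smul' := fun c a => by
        have hca : WithLp.toLp 2 (c • a, R z (E z (c • a))) =
            c • WithLp.toLp 2 (a, R z (E z a)) := by
          rw [map_smul, map_smul]; rfl
        rw [hca, map_smul]; rfl }
  have hF : ∀ z a, V (WithLp.toLp 2 (a, R z (E z a))) = WithLp.toLp 2 (F z a, E z a) :=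
    fun z a => by
      nth_rewrite 2 [← hEu z a]; rfl
  let e (a : κ) : EuclideanSpace ℂ κ := EuclideanSpace.single a 1
  refine ⟨fun z => Matrix.of fun a k => conj (F z (e a) k), ?_, fun z => ?_⟩
  -- with `E` the state map and `D` the defect kernel of `V`, `k (1 - S S*) = E E* + k D`
  · have h1 := posSemidef_of_forall_inner fun x : UnitBall N × κ => E x.1 (e x.2)
    have h2 := posSemidef_defect V hV fun x : UnitBall N × κ =>
      WithLp.toLp 2 (e x.2, R x.1 (E x.1 (e x.2)))
    have h3 := posSemidef_druryArvesonKernel (fun x : UnitBall N × κ => x.1)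
    have h4 := h1.add (h3.hadamard h2)
    unfold IsSchurMultiplier IsPositiveKernel
    convert h4 using 1
    ext ⟨z, a⟩ ⟨w, b⟩
    have hz := one_sub_inner_ne_zero z w
    have h5 : ⟪e a, e b⟫_ℂ = (1 : Matrix κ κ ℂ) a b := by
      simp [e, Matrix.one_apply, EuclideanSpace.inner_single_left]
    simp only [Matrix.of_apply, Matrix.add_apply, Matrix.hadamard_apply, hF,
      WithLp.prod_inner_apply, R, inner_rowAdjoint, h5, Matrix.smul_apply, Matrix.sub_apply,
      smul_eq_mul]
    have h6 : ⟪F z (e a), F w (e b)⟫_ℂ =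
        ((Matrix.of fun a k => conj (F z (e a) k)) * (Matrix.of fun a k => conj (F w (e a) k))ᴴ)
          a b := by
      simp [PiLp.inner_apply, Matrix.mul_apply, mul_comm]
    rw [h6, druryArvesonKernel]
    field_simp
    ring
  · ext i k
    -- on the input `P(z)* eᵢ` the state is `φ(z, i)`, so the output is `Q(z)* eᵢ`
    have h1 : E z (p (z, i)) = φ (z, i) := by
      refine ((hE z _ _).1 ?_).symm
      exact congrArg WithLp.snd (hVφ (z, i))
    have h2 : F z (p (z, i)) = t (z, i) := by
      change (V (WithLp.toLp 2 (p (z, i), R z (E z (p (z, i)))))).fst = _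
      rw [h1]
      exact congrArg WithLp.fst (hVφ (z, i))
    have h3 : p (z, i) = ∑ a, conj (P z i a) • e a := by
      ext a
      simp [p, e, Pi.single_apply]
    rw [h3, map_sum] at h2
    have h4 := congrArg (fun v : EuclideanSpace ℂ τ => conj (v k)) h2
    simpa [Matrix.mul_apply, t] using h4

/-! ### The signature form and the root of `1 + η η* / (c* J c)` -/

theorem one_add_smul_vecMulVec_posDef {q : ℕ} (η : Fin q → ℂ) {a : ℝ} (ha : 0 ≤ a) :
    (1 + (a : ℂ) • Matrix.vecMulVec η (star η)).PosDef :=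
  Matrix.PosDef.one.add_posSemidef
    ((Matrix.posSemidef_vecMulVec_self_star η).smul (by exact_mod_cast ha))

theorem cJc_eq {p q : ℕ} (ξ : Fin p → ℂ) (η : Fin q → ℂ) :
    (cJc ξ η : ℂ) = star ξ ⬝ᵥ ξ - star η ⬝ᵥ η := by
  have h : star (Sum.elim ξ η) ⬝ᵥ (signatureMatrix p q *ᵥ Sum.elim ξ η) =
      star ξ ⬝ᵥ ξ - star η ⬝ᵥ η := by
    have hs : star (Sum.elim ξ η) = Sum.elim (star ξ) (star η) := by
      ext (i | i) <;> rfl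
    rw [signatureMatrix, Matrix.fromBlocks_mulVec, hs]
    simp [sub_eq_add_neg, Matrix.neg_mulVec, Function.comp_def]
  rw [cJc, h]
  refine (Complex.conj_eq_iff_re.1 ?_)
  have hv : ∀ {n : ℕ} (v : Fin n → ℂ), conj (star v ⬝ᵥ v) = star v ⬝ᵥ v := fun v =>
    Complex.conj_eq_iff_im.2 (Complex.nonneg_iff.1 (dotProduct_star_self_nonneg v)).2.symm
  rw [map_sub, hv, hv]

theorem cJc_pos {p q : ℕ} {ξ : Fin p → ℂ} {η : Fin q → ℂ} (h : star η ⬝ᵥ η < star ξ ⬝ᵥ ξ) :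
    0 < cJc ξ η := by
  have : (0 : ℂ) < cJc ξ η := by rw [cJc_eq]; exact sub_pos.2 h
  exact_mod_cast this

theorem etaRoot_isHermitian {p q : ℕ} (ξ : Fin p → ℂ) (η : Fin q → ℂ) :
    (etaRoot ξ η)ᴴ = etaRoot ξ η :=
  (Matrix.nonneg_iff_posSemidef.1 (CFC.sqrt_nonneg _)).1

theorem etaRoot_mul_self {p q : ℕ} {ξ : Fin p → ℂ} {η : Fin q → ℂ}
    (h : star η ⬝ᵥ η < star ξ ⬝ᵥ ξ) :
    etaRoot ξ η * etaRoot ξ η = 1 + ((cJc ξ η : ℂ)⁻¹) • Matrix.vecMulVec η (star η) := by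
  refine CFC.sqrt_mul_sqrt_self _ (Matrix.nonneg_iff_posSemidef.2 ?_)
  have := one_add_smul_vecMulVec_posDef η (inv_nonneg.2 (cJc_pos h).le)
  push_cast at this
  exact this.posSemidef

theorem isUnit_etaRoot {p q : ℕ} {ξ : Fin p → ℂ} {η : Fin q → ℂ}
    (h : star η ⬝ᵥ η < star ξ ⬝ᵥ ξ) : IsUnit (etaRoot ξ η) := by
  have := one_add_smul_vecMulVec_posDef η (inv_nonneg.2 (cJc_pos h).le)
  push_cast at this
  have h2 := this.isUnit
  rw [← etaRoot_mul_self h, Matrix.isUnit_iff_isUnit_det, Matrix.det_mul] at h2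
  exact (Matrix.isUnit_iff_isUnit_det _).2 (isUnit_of_mul_isUnit_left h2)

/-! ### The Blaschke factor -/

theorem vecMul_dotProduct_star {m n : Type*} [Fintype m] [Fintype n] (M : Matrix m n ℂ)
    (v u : m → ℂ) :
    (v ᵥ* M) ⬝ᵥ star (u ᵥ* M) = v ⬝ᵥ ((M * Mᴴ) *ᵥ star u) := by
  rw [Matrix.star_vecMul, ← Matrix.mulVec_mulVec, Matrix.dotProduct_mulVec v M]

theorem blaschkeFactor_self {N : ℕ} (ν : UnitBall N) : blaschkeFactor ν ν = 0 := by
  simp [blaschkeFactor]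

/-- The fundamental identity
`1 - b(z) b(w)* = (1 - |ν|²) (1 - ⟨z, w⟩) / ((1 - ⟨z, ν⟩) (1 - ⟨ν, w⟩))`
of the Blaschke factor. -/
theorem blaschkeFactor_dotProduct {N : ℕ} (ν z w : UnitBall N) :
    blaschkeFactor ν z ⬝ᵥ star (blaschkeFactor ν w) =
      1 - (1 - ‖(ν : EuclideanSpace ℂ (Fin N))‖ ^ 2) *
        (1 - inner ℂ (w : EuclideanSpace ℂ (Fin N)) (z : EuclideanSpace ℂ (Fin N))) *
        druryArvesonKernel N z ν * star (druryArvesonKernel N w ν) := by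
  obtain ⟨ν, hν⟩ := ν
  obtain ⟨z, hz⟩ := z
  obtain ⟨w, hw⟩ := w
  have hν1 : ‖ν‖ < 1 := mem_ball_zero_iff.1 hν
  have hz1 := one_sub_inner_ne_zero ⟨z, hz⟩ ⟨ν, hν⟩
  have hw1 := one_sub_inner_ne_zero ⟨ν, hν⟩ ⟨w, hw⟩
  have hpos : 0 < 1 - ‖ν‖ ^ 2 := by nlinarith [norm_nonneg ν]
  have hν2 : (1 - (‖ν‖ : ℂ) ^ 2) ≠ 0 := by exact_mod_cast hpos.ne'
  have hin : ∀ a b : EuclideanSpace ℂ (Fin N), a.ofLp ⬝ᵥ star b.ofLp = ⟪b, a⟫_ℂ := fun a b =>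
    (EuclideanSpace.inner_eq_star_dotProduct b a).symm
  set G : Matrix (Fin N) (Fin N) ℂ := 1 - Matrix.vecMulVec (star ν.ofLp) ν.ofLp with hG
  have hνν : ν.ofLp ⬝ᵥ star ν.ofLp = (‖ν‖ : ℂ) ^ 2 := by
    rw [hin, inner_self_eq_norm_sq_to_K]; rfl
  -- rank-one update formula for `(I - ν* ν)⁻¹`
  have hGinv : G * (1 + (1 - (‖ν‖ : ℂ) ^ 2)⁻¹ • Matrix.vecMulVec (star ν.ofLp) ν.ofLp) = 1 := by
    rw [hG, mul_add, sub_mul, sub_mul, mul_one, one_mul, mul_smul_comm,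
      Matrix.vecMulVec_mul_vecMulVec, hνν]
    ext i j
    simp [Matrix.vecMulVec_apply]
    field_simp
    ring
  have hGpos : 0 ≤ G := by
    have hp := one_add_smul_vecMulVec_posDef (star ν.ofLp) (inv_nonneg.2 hpos.le)
    push_cast at hp
    rw [star_star] at hp
    rw [Matrix.nonneg_iff_posSemidef, ← Matrix.inv_eq_left_inv hGinv]
    exact hp.inv.posSemidef
  set W := CFC.sqrt G with hW
  have hWW : W * W = G := CFC.sqrt_mul_sqrt_self _ hGpos
  have hWH : Wᴴ = W := (Matrix.nonneg_iff_posSemidef.1 (CFC.sqrt_nonneg _)).1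
  have hWinv : W⁻¹ * (W⁻¹)ᴴ =
      1 + (1 - (‖ν‖ : ℂ) ^ 2)⁻¹ • Matrix.vecMulVec (star ν.ofLp) ν.ofLp := by
    rw [Matrix.conjTranspose_nonsing_inv, hWH, ← Matrix.mul_inv_rev, hWW]
    exact Matrix.inv_eq_right_inv hGinv
  have hsq : (Real.sqrt (1 - ‖ν‖ ^ 2) : ℂ) * Real.sqrt (1 - ‖ν‖ ^ 2) = 1 - (‖ν‖ : ℂ) ^ 2 := by
    rw [← Complex.ofReal_mul, Real.mul_self_sqrt hpos.le]; push_cast; rfl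
  have hquad : (z - ν).ofLp ⬝ᵥ ((W⁻¹ * (W⁻¹)ᴴ) *ᵥ star (w - ν).ofLp) =
      ⟪w - ν, z - ν⟫_ℂ + (1 - (‖ν‖ : ℂ) ^ 2)⁻¹ * (⟪ν, z - ν⟫_ℂ * ⟪w - ν, ν⟫_ℂ) := by
    rw [hWinv, Matrix.add_mulVec, Matrix.one_mulVec, Matrix.smul_mulVec,
      Matrix.vecMulVec_mulVec, dotProduct_add, hin, dotProduct_smul, hin]
    simp [dotProduct_smul, hin]
  simp only [blaschkeFactor, ← hG, ← hW, star_smul, smul_dotProduct, dotProduct_smul,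
    vecMul_dotProduct_star, hquad, druryArvesonKernel]
  have e1 : star (1 - ⟪ν, w⟫_ℂ) = 1 - ⟪w, ν⟫_ℂ := by
    simp
  simp only [star_div₀, e1, star_one, inner_sub_left, inner_sub_right, smul_eq_mul,
    inner_self_eq_norm_sq_to_K]
  have e2 : star ((Real.sqrt (1 - ‖ν‖ ^ 2) : ℂ)) = Real.sqrt (1 - ‖ν‖ ^ 2) := Complex.conj_ofReal _
  rw [e2]
  simp only at hz1 hw1
  set S := (Real.sqrt (1 - ‖ν‖ ^ 2) : ℂ)
  have hS : S ≠ 0 := fun h0 => hν2 (by rw [← hsq, h0, mul_zero])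
  have h3 : (‖ν‖ : ℂ) ^ 2 = 1 - S * S := by linear_combination hsq
  simp only [Complex.coe_algebraMap, h3, sub_sub_cancel]
  field_simp
  ring

theorem blaschkeFactor_dotProduct_self_le {N : ℕ} (ν z : UnitBall N) :
    blaschkeFactor ν z ⬝ᵥ star (blaschkeFactor ν z) ≤ 1 := by
  have h1 : ∀ x : UnitBall N, 0 ≤ 1 - ‖(x : EuclideanSpace ℂ (Fin N))‖ ^ 2 := fun x => by
    have : ‖(x : EuclideanSpace ℂ (Fin N))‖ < 1 := mem_ball_zero_iff.1 x.2
    nlinarith [norm_nonneg (x : EuclideanSpace ℂ (Fin N))]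
  have h2 : ∀ x : UnitBall N, (0 : ℂ) ≤ 1 - (‖(x : EuclideanSpace ℂ (Fin N))‖ : ℂ) ^ 2 :=
    fun x => by exact_mod_cast h1 x
  rw [blaschkeFactor_dotProduct, inner_self_eq_norm_sq_to_K, sub_le_self_iff, mul_assoc]
  exact mul_nonneg (mul_nonneg (h2 ν) (h2 z)) (mul_star_self_nonneg _)

/-! ### Auxiliary matrix identities -/

theorem vecMulVec_zero_right {m n : Type*} (a : m → ℂ) :
    Matrix.vecMulVec a (0 : n → ℂ) = 0 := by
  ext i j
  simp [Matrix.vecMulVec_apply]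

theorem vecMulVec_mul_conjTranspose_vecMulVec {l m n : Type*} [Fintype n] (a : l → ℂ) (a' : m → ℂ)
    (b b' : n → ℂ) (c : ℝ) :
    ((c : ℂ) • Matrix.vecMulVec a b) * ((c : ℂ) • Matrix.vecMulVec a' b')ᴴ =
      ((c : ℂ) * c * (b ⬝ᵥ star b')) • Matrix.vecMulVec a (star a') := by
  rw [Matrix.conjTranspose_smul, Matrix.conjTranspose_vecMulVec, Matrix.smul_mul, Matrix.mul_smul,
    Matrix.vecMulVec_mul_vecMulVec]
  ext i j
  simp
  ring

/-- The form `P P* - Q Q*` with `P = A - s C` and `Q = s D - B`, expanded along `(1, -s)`. The primed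
matrices stand for conjugate transposes at a second point. -/
theorem sub_mul_sub_mul_expand {m n k : Type*} [Fintype m] [Fintype n] [Fintype k]
    (A : Matrix m n ℂ) (A' : Matrix n m ℂ) (B : Matrix m k ℂ) (B' : Matrix k m ℂ)
    (C : Matrix k n ℂ) (C' : Matrix n k ℂ) (D D' : Matrix k k ℂ)
    (s : Matrix m k ℂ) (s' : Matrix k m ℂ) :
    (A - s * C) * (A' - C' * s') - (s * D - B) * (D' * s' - B') =
      (A * A' - B * B') - (A * C' - B * D') * s' - s * (C * A' - D * B') +
        s * (C * C' - D * D') * s' := by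
  simp only [Matrix.mul_sub, Matrix.sub_mul, Matrix.mul_assoc]
  abel

/-! ### The coefficient matrix of the linear fractional transformation -/

/-- The coefficient `A(z) = (ξ b_ν(z) / √(c* J c), U₁₃)` of `sν` in the numerator of the linear
fractional transformation, `U₁₃` being the matrix of the first columns of `U`. -/
noncomputable abbrev lftNumCoeff {N r q : ℕ} (ν : UnitBall N) (ξ : Fin (r + 1) → ℂ) (η : Fin q → ℂ)
    (U : Matrix (Fin (r + 1)) (Fin (r + 1)) ℂ) (z : UnitBall N) :
    Matrix (Fin (r + 1)) (Fin N ⊕ Fin r) ℂ :=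
  Matrix.fromCols
      (((Real.sqrt (cJc ξ η) : ℂ)⁻¹) • Matrix.vecMulVec ξ (blaschkeFactor ν z))
      (U.submatrix id Fin.castSucc)

/-- The coefficient `C(z) = (η b_ν(z) / √(c* J c), 0)` of `sν` in the denominator of the linear
fractional transformation. -/
noncomputable abbrev lftDenCoeff {N p q : ℕ} (r : ℕ) (ν : UnitBall N) (ξ : Fin p → ℂ)
    (η : Fin q → ℂ) (z : UnitBall N) : Matrix (Fin q) (Fin N ⊕ Fin r) ℂ :=
  Matrix.fromCols
      (((Real.sqrt (cJc ξ η) : ℂ)⁻¹) • Matrix.vecMulVec η (blaschkeFactor ν z))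
      (0 : Matrix (Fin q) (Fin r) ℂ)

/-- The values of a Schur multiplier are contractions. -/
theorem IsSchurMultiplier.posSemidef_one_sub {N : ℕ} {ι κ : Type*} [DecidableEq ι] [Fintype κ]
    {s : UnitBall N → Matrix ι κ ℂ} (hs : IsSchurMultiplier (druryArvesonKernel N) s)
    (z : UnitBall N) : (1 - s z * (s z)ᴴ).PosSemidef := by
  have h1 := Matrix.PosSemidef.submatrix hs (fun i : ι => (z, i))
  have hz : ‖(z : EuclideanSpace ℂ (Fin N))‖ < 1 := mem_ball_zero_iff.1 z.2
  have h2 : 0 < 1 - ‖(z : EuclideanSpace ℂ (Fin N))‖ ^ 2 := by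
    nlinarith [norm_nonneg (z : EuclideanSpace ℂ (Fin N))]
  have h3 : (0 : ℂ) ≤ 1 - (‖(z : EuclideanSpace ℂ (Fin N))‖ : ℂ) ^ 2 := by exact_mod_cast h2.le
  have h4 : (1 - (‖(z : EuclideanSpace ℂ (Fin N))‖ : ℂ) ^ 2) ≠ 0 := by exact_mod_cast h2.ne'
  convert h1.smul h3 using 1
  ext i j
  simp only [Matrix.smul_apply, Matrix.submatrix_apply, Matrix.of_apply, druryArvesonKernel,
    inner_self_eq_norm_sq_to_K, Complex.coe_algebraMap, smul_eq_mul]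
  field_simp

theorem sqrt_inv_mul_self {x : ℝ} (hx : 0 ≤ x) :
    (((Real.sqrt x)⁻¹ : ℝ) : ℂ) * ((Real.sqrt x)⁻¹ : ℝ) = (x : ℂ)⁻¹ := by
  rw [← Complex.ofReal_mul, ← mul_inv, Real.mul_self_sqrt hx, Complex.ofReal_inv]

/-- The first columns of the unitary `U` span the orthogonal complement of `ξ`. -/
theorem firstColumns_mul_conjTranspose {r : ℕ} {ξ : Fin (r + 1) → ℂ}
    {U : Matrix (Fin (r + 1)) (Fin (r + 1)) ℂ}
    (hU : U ∈ Matrix.unitaryGroup (Fin (r + 1)) ℂ)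
    (hUξ : ∀ i, U i (Fin.last r) = ξ i / (Real.sqrt (star ξ ⬝ᵥ ξ).re : ℂ)) :
    U.submatrix id (Fin.castSucc : Fin r → _) * (U.submatrix id (Fin.castSucc : Fin r → _))ᴴ =
      1 - (star ξ ⬝ᵥ ξ)⁻¹ • Matrix.vecMulVec ξ (star ξ) := by
  have h0 := dotProduct_star_self_nonneg ξ
  have h1 : ((star ξ ⬝ᵥ ξ).re : ℂ) = star ξ ⬝ᵥ ξ :=
    Complex.conj_eq_iff_re.1 (Complex.conj_eq_iff_im.2 (Complex.nonneg_iff.1 h0).2.symm)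
  have h2 := sqrt_inv_mul_self (Complex.nonneg_iff.1 h0).1
  rw [h1] at h2
  have hUU : U * Uᴴ = 1 := Matrix.mem_unitaryGroup_iff.1 hU
  rw [eq_sub_iff_add_eq, ← hUU, ← h2]
  ext i j
  simp only [Matrix.add_apply, Matrix.mul_apply, Fin.sum_univ_castSucc, Matrix.smul_apply,
    Matrix.vecMulVec_apply, Matrix.submatrix_apply, Matrix.conjTranspose_apply, id, hUξ,
    smul_eq_mul, Pi.star_apply, star_div₀, Complex.ofReal_inv]
  have e2 : ∀ x : ℝ, star (x : ℂ) = x := Complex.conj_ofReal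
  rw [e2]
  ring

theorem star_vecMul_firstColumns {r : ℕ} {ξ : Fin (r + 1) → ℂ}
    {U : Matrix (Fin (r + 1)) (Fin (r + 1)) ℂ}
    (hU : U ∈ Matrix.unitaryGroup (Fin (r + 1)) ℂ) (hξ : 0 < star ξ ⬝ᵥ ξ)
    (hUξ : ∀ i, U i (Fin.last r) = ξ i / (Real.sqrt (star ξ ⬝ᵥ ξ).re : ℂ)) :
    star ξ ᵥ* U.submatrix id (Fin.castSucc : Fin r → _) = 0 := by
  have hUU : Uᴴ * U = 1 := Matrix.mem_unitaryGroup_iff'.1 hU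
  have hre := (Complex.pos_iff.1 hξ).1
  ext j
  have := congrFun (congrFun hUU (Fin.last r)) j.castSucc
  rw [Matrix.one_apply_ne (Fin.castSucc_lt_last j).ne', Matrix.mul_apply] at this
  have hs : (Real.sqrt (star ξ ⬝ᵥ ξ).re : ℂ) ≠ 0 := by
    exact_mod_cast (Real.sqrt_pos.2 hre).ne'
  have e2 : ∀ x : ℝ, star (x : ℂ) = x := Complex.conj_ofReal
  simp only [Matrix.conjTranspose_apply, hUξ, star_div₀, e2, div_mul_eq_mul_div,
    ← Finset.sum_div] at this
  simpa [Matrix.vecMul, dotProduct] using (div_eq_zero_iff.1 this).resolve_right hs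

/-- `η*` is a left eigenvector of `1 + η η* / (c* J c)`, with eigenvalue `ξ* ξ / (c* J c)`. -/
theorem star_vecMul_etaRoot_inv_inv {p q : ℕ} {ξ : Fin p → ℂ} {η : Fin q → ℂ}
    (h : star η ⬝ᵥ η < star ξ ⬝ᵥ ξ) :
    star η ᵥ* ((etaRoot ξ η)⁻¹ * (etaRoot ξ η)⁻¹) =
      ((cJc ξ η : ℂ) / (star ξ ⬝ᵥ ξ)) • star η := by
  have hδ : (cJc ξ η : ℂ) ≠ 0 := by exact_mod_cast (cJc_pos h).ne'
  have hξ : star ξ ⬝ᵥ ξ ≠ 0 := ((dotProduct_star_self_nonneg η).trans_lt h).ne'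
  have h1 : star η ᵥ* (etaRoot ξ η * etaRoot ξ η) =
      ((star ξ ⬝ᵥ ξ) / (cJc ξ η : ℂ)) • star η := by
    rw [etaRoot_mul_self h, Matrix.vecMul_add, Matrix.vecMul_one, Matrix.vecMul_smul,
      Matrix.vecMul_vecMulVec, smul_smul]
    nth_rewrite 1 [← one_smul ℂ (star η)]
    rw [← add_smul]
    congr 1
    have := cJc_eq ξ η
    field_simp
    rw [this]
    ring
  have hu := isUnit_etaRoot h
  have hu2 : IsUnit (etaRoot ξ η * etaRoot ξ η) := hu.mul hu
  rw [← Matrix.mul_inv_rev]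
  have h3 : star η ᵥ* (etaRoot ξ η * etaRoot ξ η) ᵥ* (etaRoot ξ η * etaRoot ξ η)⁻¹ = star η := by
    rw [Matrix.vecMul_vecMul, Matrix.mul_nonsing_inv _ ((Matrix.isUnit_iff_isUnit_det _).1 hu2),
      Matrix.vecMul_one]
  rw [h1, Matrix.smul_vecMul] at h3
  rw [← h3, smul_smul, h3, div_mul_div_cancel₀ hξ, div_self hδ, one_smul]

/-- The upper left block of `Θ(z) J Θ(w)* = J - c c* (1 - b(z) b(w)*) / (c* J c)`. -/
theorem lftNumCoeff_mul {N r q : ℕ} {ν : UnitBall N} {ξ : Fin (r + 1) → ℂ} {η : Fin q → ℂ}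
    (h : star η ⬝ᵥ η < star ξ ⬝ᵥ ξ)
    {U : Matrix (Fin (r + 1)) (Fin (r + 1)) ℂ}
    (hU : U ∈ Matrix.unitaryGroup (Fin (r + 1)) ℂ)
    (hUξ : ∀ i, U i (Fin.last r) = ξ i / (Real.sqrt (star ξ ⬝ᵥ ξ).re : ℂ)) (z w : UnitBall N) :
    lftNumCoeff ν ξ η U z * (lftNumCoeff ν ξ η U w)ᴴ -
      ((cJc ξ η : ℂ)⁻¹ • (Matrix.vecMulVec ξ (star η) * (etaRoot ξ η)⁻¹)) *
      ((cJc ξ η : ℂ)⁻¹ • (Matrix.vecMulVec ξ (star η) * (etaRoot ξ η)⁻¹))ᴴ =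
    1 - ((cJc ξ η : ℂ)⁻¹ * (1 - blaschkeFactor ν z ⬝ᵥ star (blaschkeFactor ν w))) •
      Matrix.vecMulVec ξ (star ξ) := by
  have hδ : (cJc ξ η : ℂ) ≠ 0 := by exact_mod_cast (cJc_pos h).ne'
  have hξ : star ξ ⬝ᵥ ξ ≠ 0 := ((dotProduct_star_self_nonneg η).trans_lt h).ne'
  have e1 : star ((cJc ξ η : ℂ)⁻¹) = (cJc ξ η : ℂ)⁻¹ := by
    rw [← Complex.ofReal_inv]; exact Complex.conj_ofReal _
  rw [lftNumCoeff, lftNumCoeff, Matrix.conjTranspose_fromCols_eq_fromRows_conjTranspose,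
    Matrix.fromCols_mul_fromRows, firstColumns_mul_conjTranspose hU hUξ,
    ← Complex.ofReal_inv (Real.sqrt _), vecMulVec_mul_conjTranspose_vecMulVec,
    sqrt_inv_mul_self (cJc_pos h).le, Matrix.conjTranspose_smul, Matrix.conjTranspose_mul, e1,
    Matrix.conjTranspose_nonsing_inv, etaRoot_isHermitian, Matrix.smul_mul,
    Matrix.mul_smul, smul_smul, Matrix.mul_assoc,
    ← Matrix.mul_assoc _ _ (Matrix.vecMulVec ξ (star η))ᴴ, ← Matrix.mul_assoc,
    Matrix.vecMulVec_mul, star_vecMul_etaRoot_inv_inv h, Matrix.conjTranspose_vecMulVec,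
    star_star, Matrix.vecMulVec_mul_vecMulVec, smul_dotProduct]
  have h3 : star η ⬝ᵥ η = star ξ ⬝ᵥ ξ - cJc ξ η := by rw [cJc_eq]; ring
  rw [h3]
  ext i j
  simp only [Matrix.add_apply, Matrix.sub_apply, Matrix.smul_apply, smul_eq_mul,
    Matrix.vecMulVec_apply, Pi.smul_apply, Pi.star_apply]
  field_simp
  ring

/-- The upper right block of `Θ(z) J Θ(w)* = J - c c* (1 - b(z) b(w)*) / (c* J c)`. -/
theorem lftNumCoeff_mul_lftDenCoeff {N r q : ℕ} {ν : UnitBall N} {ξ : Fin (r + 1) → ℂ}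
    {η : Fin q → ℂ} (h : star η ⬝ᵥ η < star ξ ⬝ᵥ ξ)
    (U : Matrix (Fin (r + 1)) (Fin (r + 1)) ℂ)
    (z w : UnitBall N) :
    lftNumCoeff ν ξ η U z * (lftDenCoeff r ν ξ η w)ᴴ -
      ((cJc ξ η : ℂ)⁻¹ • (Matrix.vecMulVec ξ (star η) * (etaRoot ξ η)⁻¹)) * (etaRoot ξ η)ᴴ =
    -(((cJc ξ η : ℂ)⁻¹ * (1 - blaschkeFactor ν z ⬝ᵥ star (blaschkeFactor ν w))) •
      Matrix.vecMulVec ξ (star η)) := by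
  have hu := (Matrix.isUnit_iff_isUnit_det _).1 (isUnit_etaRoot h)
  rw [lftNumCoeff, lftDenCoeff, Matrix.conjTranspose_fromCols_eq_fromRows_conjTranspose,
    Matrix.fromCols_mul_fromRows, ← Complex.ofReal_inv (Real.sqrt _),
    vecMulVec_mul_conjTranspose_vecMulVec, sqrt_inv_mul_self (cJc_pos h).le,
    etaRoot_isHermitian, Matrix.smul_mul, Matrix.mul_assoc, Matrix.nonsing_inv_mul _ hu]
  ext i j
  simp
  ring

/-- The lower right block of `Θ(z) J Θ(w)* = J - c c* (1 - b(z) b(w)*) / (c* J c)`. -/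
theorem lftDenCoeff_mul {N r q : ℕ} {ν : UnitBall N} {ξ : Fin (r + 1) → ℂ} {η : Fin q → ℂ}
    (h : star η ⬝ᵥ η < star ξ ⬝ᵥ ξ)
    (z w : UnitBall N) :
    lftDenCoeff r ν ξ η z * (lftDenCoeff r ν ξ η w)ᴴ - etaRoot ξ η * (etaRoot ξ η)ᴴ =
    -1 - ((cJc ξ η : ℂ)⁻¹ * (1 - blaschkeFactor ν z ⬝ᵥ star (blaschkeFactor ν w))) •
      Matrix.vecMulVec η (star η) := by
  rw [lftDenCoeff, lftDenCoeff, Matrix.conjTranspose_fromCols_eq_fromRows_conjTranspose,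
    Matrix.fromCols_mul_fromRows, ← Complex.ofReal_inv (Real.sqrt _),
    vecMulVec_mul_conjTranspose_vecMulVec, sqrt_inv_mul_self (cJc_pos h).le,
    etaRoot_isHermitian, etaRoot_mul_self h]
  ext i j
  simp
  ring

/-! ### Range of the linear fractional transformation -/

/-- The denominator is invertible: if `x (C sν + D) = 0` then, `sν(z)` being a contraction,
`|x D|² ≤ |x C|²`, whereas `C C* - D D* ≤ -1`. -/
theorem isUnit_lftDen {N r q : ℕ} {ν : UnitBall N} {ξ : Fin (r + 1) → ℂ} {η : Fin q → ℂ}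
    (h : star η ⬝ᵥ η < star ξ ⬝ᵥ ξ)
    {sν : UnitBall N → Matrix (Fin N ⊕ Fin r) (Fin q) ℂ}
    (hs : IsSchurMultiplier (druryArvesonKernel N) sν) (z : UnitBall N) :
    IsUnit (lftDen ν ξ η sν z) := by
  have hδ : (0 : ℂ) ≤ (cJc ξ η : ℂ)⁻¹ := by exact_mod_cast (inv_pos.2 (cJc_pos h)).le
  rw [← Matrix.vecMul_injective_iff_isUnit]
  refine (injective_iff_map_eq_zero (Matrix.vecMulLinear (lftDen ν ξ η sν z))).2 fun x hx => ?_
  rw [Matrix.vecMulLinear_apply] at hx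
  have h0 : lftDen ν ξ η sν z = lftDenCoeff r ν ξ η z * sν z + etaRoot ξ η := rfl
  rw [h0, Matrix.vecMul_add, ← Matrix.vecMul_vecMul] at hx
  set y := x ᵥ* lftDenCoeff r ν ξ η z with hy
  have h1 : x ᵥ* etaRoot ξ η = -(y ᵥ* sν z) := by rw [← add_eq_zero_iff_eq_neg']; exact hx
  have h2 : (x ᵥ* etaRoot ξ η) ⬝ᵥ star (x ᵥ* etaRoot ξ η) = y ⬝ᵥ star y -
      y ⬝ᵥ ((1 - sν z * (sν z)ᴴ) *ᵥ star y) := by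
    rw [h1, star_neg, neg_dotProduct_neg, vecMul_dotProduct_star, Matrix.sub_mulVec,
      dotProduct_sub, Matrix.one_mulVec, sub_sub_cancel]
  have h3 : 0 ≤ y ⬝ᵥ ((1 - sν z * (sν z)ᴴ) *ᵥ star y) := by
    simpa using (hs.posSemidef_one_sub z).dotProduct_mulVec_nonneg (star y)
  have h4 : y ⬝ᵥ star y - (x ᵥ* etaRoot ξ η) ⬝ᵥ star (x ᵥ* etaRoot ξ η) =
      -(x ⬝ᵥ star x) - ((cJc ξ η : ℂ)⁻¹ *
        (1 - blaschkeFactor ν z ⬝ᵥ star (blaschkeFactor ν z))) *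
        ((x ⬝ᵥ η) * star (x ⬝ᵥ η)) := by
    rw [hy, vecMul_dotProduct_star, vecMul_dotProduct_star, ← dotProduct_sub, ← Matrix.sub_mulVec,
      lftDenCoeff_mul h, Matrix.sub_mulVec, dotProduct_sub, Matrix.neg_mulVec, Matrix.one_mulVec,
      dotProduct_neg, Matrix.smul_mulVec, dotProduct_smul, Matrix.vecMulVec_mulVec]
    simp [Matrix.star_dotProduct_star, dotProduct_comm]
    exact Or.inl (mul_comm _ _)
  have h5 : 0 ≤ ((cJc ξ η : ℂ)⁻¹ * (1 - blaschkeFactor ν z ⬝ᵥ star (blaschkeFactor ν z))) *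
        ((x ⬝ᵥ η) * star (x ⬝ᵥ η)) :=
    mul_nonneg (mul_nonneg hδ (sub_nonneg.2 (blaschkeFactor_dotProduct_self_le ν z)))
      (mul_star_self_nonneg _)
  have h6 : x ⬝ᵥ star x ≤ 0 := by
    rw [h2, sub_sub_cancel] at h4
    have : x ⬝ᵥ star x = -(y ⬝ᵥ ((1 - sν z * (sν z)ᴴ) *ᵥ star y) +
      ((cJc ξ η : ℂ)⁻¹ * (1 - blaschkeFactor ν z ⬝ᵥ star (blaschkeFactor ν z))) *
        ((x ⬝ᵥ η) * star (x ⬝ᵥ η))) := by rw [h4]; ring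
    rw [this]
    exact neg_nonpos.2 (add_nonneg h3 h5)
  exact dotProduct_self_star_eq_zero.1 (le_antisymm h6 (dotProduct_self_star_nonneg x))

/-- The interpolation condition holds for every parameter: at `ν` the Blaschke factor vanishes and
`ξ*` annihilates the first columns of `U`, so only `ξ* B D⁻¹ = η*` remains. -/
theorem star_vecMul_lft {N r q : ℕ} {ν : UnitBall N} {ξ : Fin (r + 1) → ℂ} {η : Fin q → ℂ}
    (h : star η ⬝ᵥ η < star ξ ⬝ᵥ ξ) {U : Matrix (Fin (r + 1)) (Fin (r + 1)) ℂ}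
    (hU : U ∈ Matrix.unitaryGroup (Fin (r + 1)) ℂ)
    (hUξ : ∀ i, U i (Fin.last r) = ξ i / (Real.sqrt (star ξ ⬝ᵥ ξ).re : ℂ))
    (sν : UnitBall N → Matrix (Fin N ⊕ Fin r) (Fin q) ℂ) :
    star ξ ᵥ* (lftNum ν ξ η U sν ν * (lftDen ν ξ η sν ν)⁻¹) = star η := by
  have hδ : (cJc ξ η : ℂ) ≠ 0 := by exact_mod_cast (cJc_pos h).ne'
  have hξ : 0 < star ξ ⬝ᵥ ξ := (dotProduct_star_self_nonneg η).trans_lt h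
  have hA : star ξ ᵥ* lftNumCoeff ν ξ η U ν = 0 := by
    rw [lftNumCoeff, blaschkeFactor_self, vecMulVec_zero_right, smul_zero, Matrix.vecMul_fromCols,
      star_vecMul_firstColumns hU hξ hUξ, Matrix.vecMul_zero]
    ext (i | i) <;> rfl
  have hC : lftDenCoeff r ν ξ η ν = 0 := by
    rw [lftDenCoeff, blaschkeFactor_self, vecMulVec_zero_right, smul_zero, Matrix.fromCols_zero]
  have hD : lftDen ν ξ η sν ν = etaRoot ξ η := by
    change lftDenCoeff r ν ξ η ν * sν ν + etaRoot ξ η = _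
    rw [hC, Matrix.zero_mul, zero_add]
  rw [hD]
  change star ξ ᵥ* ((lftNumCoeff ν ξ η U ν * sν ν + _) * _) = _
  rw [Matrix.add_mul, Matrix.vecMul_add, Matrix.mul_assoc, ← Matrix.vecMul_vecMul, hA,
    Matrix.zero_vecMul, zero_add, Matrix.smul_mul, Matrix.mul_assoc, Matrix.vecMulVec_mul,
    star_vecMul_etaRoot_inv_inv h, Matrix.vecMul_smul, Matrix.vecMul_vecMulVec, smul_smul,
    smul_smul, inv_mul_eq_div, div_mul_div_cancel₀ hδ, div_self hξ.ne', one_smul]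

/-- Every interpolant is a linear fractional transform: the Schur complement of the kernel of `s`
along `ξ` at `ν` is `k (P P* - Q Q*)` with `P = A - s C` and `Q = s D - B`, and the equation
`P sν = Q` given by Leech's theorem is equivalent to the linear fractional formula. -/
theorem exists_lft {N r q : ℕ} {s : UnitBall N → Matrix (Fin (r + 1)) (Fin q) ℂ}
    (hs : IsSchurMultiplier (druryArvesonKernel N) s)
    {ν : UnitBall N} {ξ : Fin (r + 1) → ℂ} {η : Fin q → ℂ}
    (h : star η ⬝ᵥ η < star ξ ⬝ᵥ ξ) {U : Matrix (Fin (r + 1)) (Fin (r + 1)) ℂ}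
    (hU : U ∈ Matrix.unitaryGroup (Fin (r + 1)) ℂ)
    (hUξ : ∀ i, U i (Fin.last r) = ξ i / (Real.sqrt (star ξ ⬝ᵥ ξ).re : ℂ))
    (hν : star ξ ᵥ* s ν = star η) :
    ∃ sν : UnitBall N → Matrix (Fin N ⊕ Fin r) (Fin q) ℂ,
      IsSchurMultiplier (druryArvesonKernel N) sν ∧
      ∀ z, s z = lftNum ν ξ η U sν z * (lftDen ν ξ η sν z)⁻¹ := by
  set B := (cJc ξ η : ℂ)⁻¹ • (Matrix.vecMulVec ξ (star η) * (etaRoot ξ η)⁻¹) with hB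
  have hδ : (cJc ξ η : ℂ) ≠ 0 := by exact_mod_cast (cJc_pos h).ne'
  have hν1 : ‖(ν : EuclideanSpace ℂ (Fin N))‖ < 1 := mem_ball_zero_iff.1 ν.2
  have hν2 : 0 < 1 - ‖(ν : EuclideanSpace ℂ (Fin N))‖ ^ 2 := by
    nlinarith [norm_nonneg (ν : EuclideanSpace ℂ (Fin N))]
  have hν3 : (1 - (‖(ν : EuclideanSpace ℂ (Fin N))‖ : ℂ) ^ 2) ≠ 0 := by exact_mod_cast hν2.ne'
  have hν4 : (s ν)ᴴ *ᵥ ξ = η := by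
    rw [← star_inj, Matrix.star_mulVec, Matrix.conjTranspose_conjTranspose, hν]
  let K : Matrix (UnitBall N × Fin (r + 1)) (UnitBall N × Fin (r + 1)) ℂ := Matrix.of fun x y =>
    druryArvesonKernel N x.1 y.1 *
      (1 - s x.1 * (s y.1)ᴴ : Matrix (Fin (r + 1)) (Fin (r + 1)) ℂ) x.2 y.2
  have hK : K.PosSemidef := hs
  -- the values of the kernel of `s` in the direction `ξ` at `ν`
  have hcol : ∀ x : UnitBall N × Fin (r + 1), ∑ i, K x (ν, i) * ξ i =
      druryArvesonKernel N x.1 ν * (ξ - s x.1 *ᵥ η) x.2 := fun x => by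
    have : (ξ - s x.1 *ᵥ η) = (1 - s x.1 * (s ν)ᴴ) *ᵥ ξ := by
      rw [Matrix.sub_mulVec, Matrix.one_mulVec, ← Matrix.mulVec_mulVec, hν4]
    rw [this, Matrix.mulVec, dotProduct, Finset.mul_sum]
    exact Finset.sum_congr rfl fun i _ => mul_assoc _ _ _
  have hdiag : ∑ i, ∑ j, star (ξ i) * K (ν, i) (ν, j) * ξ j =
      (cJc ξ η / (1 - ‖(ν : EuclideanSpace ℂ (Fin N))‖ ^ 2) : ℝ) := by
    simp only [mul_assoc, ← Finset.mul_sum, hcol]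
    have h1 : star ξ ⬝ᵥ (ξ - s ν *ᵥ η) = cJc ξ η := by
      rw [dotProduct_sub, Matrix.dotProduct_mulVec, hν, cJc_eq]
    rw [Complex.ofReal_div, ← h1, dotProduct, Finset.sum_div]
    refine Finset.sum_congr rfl fun i _ => ?_
    simp only [druryArvesonKernel, inner_self_eq_norm_sq_to_K, Complex.coe_algebraMap,
      Pi.star_apply]
    push_cast
    field_simp
  have hpos := Matrix.PosSemidef.sub_rankOne hK (fun i => (ν, i)) ξ hdiag
    (div_pos (cJc_pos h) hν2)
  obtain ⟨sν, hsν, hPQ⟩ := exists_schurMultiplier_mul_eq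
    (fun z => lftNumCoeff ν ξ η U z - s z * lftDenCoeff r ν ξ η z)
    (fun z => s z * etaRoot ξ η - B) (by
      unfold IsPositiveKernel
      convert hpos using 1
      ext ⟨z, i⟩ ⟨w, j⟩
      -- `Θ(z) J Θ(w)*` compressed by `(1, -s(z))` and `(1, -s(w))*`
      have hmat : (lftNumCoeff ν ξ η U z - s z * lftDenCoeff r ν ξ η z) *
          (lftNumCoeff ν ξ η U w - s w * lftDenCoeff r ν ξ η w)ᴴ -
          (s z * etaRoot ξ η - B) * (s w * etaRoot ξ η - B)ᴴ =
          1 - s z * (s w)ᴴ - ((cJc ξ η : ℂ)⁻¹ *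
            (1 - blaschkeFactor ν z ⬝ᵥ star (blaschkeFactor ν w))) •
            Matrix.vecMulVec (ξ - s z *ᵥ η) (star (ξ - s w *ᵥ η)) := by
        have e : star ((cJc ξ η : ℂ)⁻¹) = (cJc ξ η : ℂ)⁻¹ := by
          rw [← Complex.ofReal_inv]; exact Complex.conj_ofReal _
        have h1 := lftNumCoeff_mul (ν := ν) h hU hUξ z w
        have h2 := lftNumCoeff_mul_lftDenCoeff (ν := ν) h U z w
        have h3 := congrArg Matrix.conjTranspose (lftNumCoeff_mul_lftDenCoeff (ν := ν) h U w z)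
        have h4 := lftDenCoeff_mul (r := r) (ν := ν) h z w
        rw [← hB] at h1 h2 h3
        clear_value B
        rw [Matrix.conjTranspose_sub, Matrix.conjTranspose_mul, Matrix.conjTranspose_mul,
          Matrix.conjTranspose_conjTranspose, Matrix.conjTranspose_conjTranspose,
          Matrix.conjTranspose_neg, Matrix.conjTranspose_smul, Matrix.conjTranspose_vecMulVec,
          star_star, star_mul', e, star_sub, star_one, ← Matrix.dotProduct_star] at h3
        rw [Matrix.conjTranspose_sub, Matrix.conjTranspose_sub, Matrix.conjTranspose_mul,
          Matrix.conjTranspose_mul]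
        rw [sub_mul_sub_mul_expand, h1, h2, h3, h4]
        rw [Matrix.sub_vecMulVec, star_sub, Matrix.star_mulVec, Matrix.vecMulVec_sub,
          Matrix.vecMulVec_sub]
        simp only [Matrix.mul_sub, Matrix.sub_mul, Matrix.neg_mul, Matrix.mul_neg, Matrix.smul_mul,
          Matrix.mul_smul, Matrix.vecMulVec_mul, Matrix.mul_vecMulVec, Matrix.mul_one, smul_sub]
        abel
      have hzw := one_sub_inner_ne_zero z w
      have hkzw : druryArvesonKernel N z w =
          1 / (1 - ⟪(w : EuclideanSpace ℂ (Fin N)), z⟫_ℂ) := rfl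
      simp only [Matrix.of_apply, hcol, hmat]
      rw [blaschkeFactor_dotProduct, Matrix.smul_apply, Matrix.sub_apply,
        Matrix.smul_apply, Matrix.vecMulVec_apply, star_mul']
      simp only [K, Matrix.of_apply, smul_eq_mul, Pi.star_apply]
      rw [hkzw]
      push_cast
      field_simp
      ring)
  refine ⟨sν, hsν, fun z => ?_⟩
  have hu := (Matrix.isUnit_iff_isUnit_det _).1 (isUnit_lftDen (ν := ν) h hsν z)
  have h1 : s z * lftDen ν ξ η sν z = lftNum ν ξ η U sν z := by
    change s z * (lftDenCoeff r ν ξ η z * sν z + etaRoot ξ η) =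
      lftNumCoeff ν ξ η U z * sν z + B
    have h2 := hPQ z
    rw [Matrix.sub_mul, Matrix.mul_assoc, sub_eq_sub_iff_add_eq_add] at h2
    rw [Matrix.mul_add, eq_comm, h2]
    exact add_comm _ _
  rw [← h1, Matrix.mul_assoc, Matrix.mul_nonsing_inv _ hu, Matrix.mul_one]

/-! ### The tangential Schwarz lemma -/

theorem mainTheorem2 (N r q : ℕ)
    (s : UnitBall N → Matrix (Fin (r + 1)) (Fin q) ℂ)
    (hs : IsSchurMultiplier (druryArvesonKernel N) s)
    (ν : UnitBall N) (ξ : Fin (r + 1) → ℂ) (η : Fin q → ℂ)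
    (hξη : star η ⬝ᵥ η < star ξ ⬝ᵥ ξ)
    (U : Matrix (Fin (r + 1)) (Fin (r + 1)) ℂ)
    (hU : U ∈ Matrix.unitaryGroup (Fin (r + 1)) ℂ)
    (hUξ : ∀ i, U i (Fin.last r) = ξ i / (Real.sqrt (star ξ ⬝ᵥ ξ).re : ℂ)) :
    (∀ sν : UnitBall N → Matrix (Fin N ⊕ Fin r) (Fin q) ℂ,
      IsSchurMultiplier (druryArvesonKernel N) sν → ∀ z, IsUnit (lftDen ν ξ η sν z)) ∧
    (star ξ ᵥ* s ν = star η ↔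
      ∃ sν : UnitBall N → Matrix (Fin N ⊕ Fin r) (Fin q) ℂ,
        IsSchurMultiplier (druryArvesonKernel N) sν ∧
        ∀ z, s z = lftNum ν ξ η U sν z * (lftDen ν ξ η sν z)⁻¹) := by
  refine ⟨fun sν hsν z => isUnit_lftDen hξη hsν z,
    fun hν => exists_lft hs hξη hU hUξ hν, ?_⟩
  rintro ⟨sν, -, hsν⟩
  rw [hsν ν]
  exact star_vecMul_lft hξη hU hUξ sν
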